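/- Let $0<\tau<L$. For a convex set $\mathcal B\subset\mathbb R^n$ with nonempty interior, let $\mathcal F_{\tau,L,\mathcal B}$ be the class of differentiable functions $f:\mathcal B\to\mathbb R$ that satisfy $f(y)\ge f(x)+\langle\nabla f(x),y-x\rangle+\frac{\tau}{2}\|x-y\|^2$ and $\|\nabla f(x)-\nabla f(y)\|\le L\|x-y\|$ for all $x,y\in\mathcal B$ (Euclidean norm), and that attain their minimum over $\mathcal B$ at a point $x_f^*\in\mathcal B$. A function evaluation oracle for $f$ with variance $\sigma^2$ answers a query $x\in\mathcal B$ with $E_f(x)=f(x)+w$, where $w$ is drawn, independently of everything else, from a law on $\mathbb R$ with $\mathbb E[w]=0$ and $\mathbb E[w^2]=\sigma^2$. There is a constant $c>0$, depending only on $\tau$ and $L$ (in particular not on $T$ or $n$), such that for every $n\ge 8$, every convex $\mathcal B\subset\mathbb R^n$ with nonempty interior, every $\sigma>0$, and all sufficiently large $T$ (how large may depend on $\tau,L,n,\mathcal B,\sigma$), $$\inf_{\widehat x_T}\ \sup_{f,\,E_f}\ \mathbb E\left[f(\widehat x_T)-f(x_f^*)\right]\ \ge\ c\left(\frac{n\sigma^2}{T}\right)^{1/2}.$$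 Here the infimum is over all (adaptive, possibly randomized) methods that make $T$ queries to the oracle at points of $\mathcal B$ and output an estimate $\widehat x_T\in\mathcal B$; the supremum is over all $f\in\mathcal F_{\tau,L,\mathcal B}$ and all function evaluation oracles for $f$ with variance $\sigma^2$; and the expectation is over the noise and the randomization of the method. -/

import Mathlib

open MeasureTheory Filter

universe u

noncomputable section

namespace DFO

/-- `f` has a gradient at every point of `B` (relative to `B`, so only the values of `f` on `B`
matter) and is strongly convex on `B` with constant `τ > 0`. -/
structure StronglyConvexWith {n : ℕ} (τ : ℝ) (f : EuclideanSpace ℝ (Fin n) → ℝ)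
    (B : Set (EuclideanSpace ℝ (Fin n))) : Prop where
  pos : 0 < τ
  differentiableOn : DifferentiableOn ℝ f B
  lower_bound : ∀ x ∈ B, ∀ y ∈ B,
    f x + inner ℝ (gradientWithin f B x) (y - x) + τ / 2 * ‖x - y‖ ^ 2 ≤ f y

/-- The gradient of `f` is Lipschitz on `B` with constant `L > 0`. -/
structure LipschitzGradientWith {n : ℕ} (L : ℝ) (f : EuclideanSpace ℝ (Fin n) → ℝ)
    (B : Set (EuclideanSpace ℝ (Fin n))) : Prop where
  pos : 0 < L
  lipschitz : ∀ x ∈ B, ∀ y ∈ B,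
    ‖gradientWithin f B x - gradientWithin f B y‖ ≤ L * ‖x - y‖

/-- The class of strongly convex functions with Lipschitz gradients on `B`, with parameters
`τ` and `L`, which take their minimum over `B` at a point of `B`. -/
def functionClass {n : ℕ} (τ L : ℝ) (B : Set (EuclideanSpace ℝ (Fin n))) :
    Set (EuclideanSpace ℝ (Fin n) → ℝ) :=
  {f | StronglyConvexWith τ f B ∧ LipschitzGradientWith L f B ∧ ∃ x ∈ B, IsMinOn f B x}

/-- `ν` is the law of the additive noise of a function evaluation oracle with variance `σ²`:
a square-integrable law on `ℝ` with mean zero and second moment `σ²`. -/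
structure IsNoiseLaw (σ : ℝ) (ν : Measure ℝ) : Prop where
  isProbabilityMeasure : IsProbabilityMeasure ν
  memLp : MemLp id 2 ν
  mean : ∫ w, w ∂ν = 0
  second_moment : ∫ w, w ^ 2 ∂ν = σ ^ 2

/-- A (possibly randomized, adaptive) derivative-free method making `T` queries in `B`.
It first draws a random seed. The `k`-th query point is a measurable function of the seed and of
the `k` answers received before (the earlier query points are functions of these as well).
After `T` answers it outputs an estimate of the minimizer in `B`. -/
structure Method {n : ℕ} (B : Set (EuclideanSpace ℝ (Fin n))) (T : ℕ) where
  Seed : Type u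
  [measurableSpace : MeasurableSpace Seed]
  seedLaw : Measure Seed
  [isProbabilityMeasure : IsProbabilityMeasure seedLaw]
  query : ∀ k : Fin T, Seed × (Fin (k : ℕ) → ℝ) → B
  measurable_query : ∀ k, Measurable (query k)
  output : Seed × (Fin T → ℝ) → B
  measurable_output : Measurable output

attribute [instance] Method.measurableSpace Method.isProbabilityMeasure

/-- The first `k` answers of the oracle: the `j`-th answer is `f (x_j) + w_j`, where `x_j` is the
`j`-th query point and `w_j` the `j`-th noise variable. -/
def Method.answers {n : ℕ} {B : Set (EuclideanSpace ℝ (Fin n))} {T : ℕ} (A : Method B T)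
    (f : EuclideanSpace ℝ (Fin n) → ℝ) (s : A.Seed) (w : Fin T → ℝ) :
    (k : ℕ) → k ≤ T → (Fin k → ℝ)
  | 0, _ => Fin.elim0
  | k + 1, h =>
    Fin.snoc (α := fun _ => ℝ) (A.answers f s w k (Nat.le_of_succ_le h))
      (f (A.query ⟨k, h⟩ (s, A.answers f s w k (Nat.le_of_succ_le h))) + w ⟨k, h⟩)

/-- The estimate produced by the method run on `f` with seed `s` and noise sequence `w`. -/
def Method.estimate {n : ℕ} {B : Set (EuclideanSpace ℝ (Fin n))} {T : ℕ} (A : Method B T)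
    (f : EuclideanSpace ℝ (Fin n) → ℝ) (s : A.Seed) (w : Fin T → ℝ) :
    EuclideanSpace ℝ (Fin n) :=
  A.output (s, A.answers f s w T le_rfl)

/-- The expected error `𝔼 [f (x̂_T) - f (x_f^*)]`, with values in `[0, ∞]`. The noise variables are
independent with law `ν`, and independent of the seed. For `f` in the function class the infimum
of `f` over `B` is its minimum `f (x_f^*)`. -/
def Method.expectedError {n : ℕ} {B : Set (EuclideanSpace ℝ (Fin n))} {T : ℕ} (A : Method B T)
    (f : EuclideanSpace ℝ (Fin n) → ℝ) (ν : Measure ℝ) : ENNReal :=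
  ∫⁻ p, ENNReal.ofReal (f (A.estimate f p.1 p.2) - sInf (f '' B))
    ∂(A.seedLaw.prod (Measure.pi fun _ : Fin T => ν))

/-- The minimax error: infimum over all methods with `T` queries, supremum over all functions of
the class and all function evaluation oracles with variance `σ²`. -/
def minimaxError {n : ℕ} (τ L σ : ℝ) (B : Set (EuclideanSpace ℝ (Fin n))) (T : ℕ) : ENNReal :=
  ⨅ A : Method.{u} B T, ⨆ f ∈ functionClass τ L B, ⨆ (ν : Measure ℝ) (_ : IsNoiseLaw σ ν),
    A.expectedError f ν

end DFO

end

/-!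
Write `τ = μ - κ` and `L = μ + κ`. Perturbing the quadratic `μ / 2 * ‖x - x₀‖ ^ 2` by a sine ridge
`κ * r ^ 2 * sin (⟪u, x - p⟫ / r)` keeps it in the class, changes its values by at most
`Δ = κ * r ^ 2`, and yet moves the minimizer by `κ * r / μ` in the direction `u`; missing the
minimizer by a fixed fraction of this distance costs a fixed multiple of `Δ`.

Let `u` range over the `2 ^ n` normalized sign vectors. Run a method on the unperturbed quadratic:
by Hoeffding's inequality every point is close to at most `2 ^ n * exp (- 3 * n / 8)` of the
displaced minimizers, so some minimizer is hit with probability at most `exp (- 3 * n / 8)`. With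
Gaussian noise each answer multiplies the second moment of the likelihood ratio between the two
oracles by at most `exp (Δ ^ 2 / σ ^ 2)`. So as long as `T * Δ ^ 2 / σ ^ 2 ≤ n / 8`, the
Cauchy–Schwarz inequality bounds the probability of hitting that minimizer on its own perturbed
quadratic by `exp (- n / 8)`, and the method errs by a multiple of `Δ`, which may be taken of order
`√(n * σ ^ 2 / T)`.
-/

noncomputable section

namespace DFO

open ProbabilityTheory Metric
open scoped ENNReal NNReal RealInnerProductSpace

section PerturbedQuadratic

variable {E : Type*} [NormedAddCommGroup E] [InnerProductSpace ℝ E]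

/-- The quadratic of curvature `μ` centred at `x₀`, minus the perturbation `h`. -/
def perturbedQuadratic (μ : ℝ) (x₀ : E) (h : E → ℝ) (x : E) : ℝ :=
  μ / 2 * ‖x - x₀‖ ^ 2 - h x

variable {μ κ : ℝ} {x₀ p : E} {h : E → ℝ} {h' : E → E}

theorem norm_gradient_perturbedQuadratic_sub_le (hμ : 0 ≤ μ)
    (hκ : ∀ x y, ‖h' x - h' y‖ ≤ κ * ‖x - y‖) (x y : E) :
    ‖(μ • (x - x₀) - h' x) - (μ • (y - x₀) - h' y)‖ ≤ (μ + κ) * ‖x - y‖ :=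
  calc ‖(μ • (x - x₀) - h' x) - (μ • (y - x₀) - h' y)‖ = ‖μ • (x - y) - (h' x - h' y)‖ := by
        congr 1; module
    _ ≤ ‖μ • (x - y)‖ + ‖h' x - h' y‖ := norm_sub_le _ _
    _ ≤ μ * ‖x - y‖ + κ * ‖x - y‖ := by
        rw [norm_smul, Real.norm_of_nonneg hμ]
        gcongr
        exact hκ x y
    _ = (μ + κ) * ‖x - y‖ := by ring

variable [CompleteSpace E]

theorem le_tangent_add_sq_of_lipschitz_gradient (hh : ∀ x, HasGradientAt h (h' x) x)
    (hκ : ∀ x y, ‖h' x - h' y‖ ≤ κ * ‖x - y‖) (x y : E) :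
    h y ≤ h x + ⟪h' x, y - x⟫ + κ / 2 * ‖x - y‖ ^ 2 := by
  set d := y - x
  have hline (t : ℝ) : HasDerivAt (fun t : ℝ ↦ h (x + t • d)) ⟪h' (x + t • d), d⟫ t := by
    have hγ : HasDerivAt (fun t : ℝ ↦ x + t • d) d t := by
      simpa using ((hasDerivAt_id t).smul_const d).const_add x
    simpa [Function.comp_def] using (hh (x + t • d)).hasFDerivAt.comp_hasDerivAt t hγ
  have hparabola (t : ℝ) : HasDerivAt (fun t : ℝ ↦ h x + t * ⟪h' x, d⟫ + κ / 2 * ‖d‖ ^ 2 * t ^ 2)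
      (⟪h' x, d⟫ + κ * ‖d‖ ^ 2 * t) t := by
    refine ((((hasDerivAt_id t).mul_const ⟪h' x, d⟫).const_add (h x)).add
      ((hasDerivAt_pow 2 t).const_mul (κ / 2 * ‖d‖ ^ 2))).congr_deriv ?_
    push_cast
    ring
  have hslope : ∀ t ∈ Set.Ico (0 : ℝ) 1,
      ⟪h' (x + t • d), d⟫ ≤ ⟪h' x, d⟫ + κ * ‖d‖ ^ 2 * t := by
    intro t ht
    have hdiff : ‖h' (x + t • d) - h' x‖ ≤ κ * (t * ‖d‖) := by
      simpa [norm_smul, abs_of_nonneg ht.1] using hκ (x + t • d) x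
    calc ⟪h' (x + t • d), d⟫ = ⟪h' x, d⟫ + ⟪h' (x + t • d) - h' x, d⟫ := by
          rw [inner_sub_left]; ring
      _ ≤ ⟪h' x, d⟫ + κ * (t * ‖d‖) * ‖d‖ := by
          gcongr
          exact (real_inner_le_norm _ _).trans (by gcongr)
      _ = ⟪h' x, d⟫ + κ * ‖d‖ ^ 2 * t := by ring
  have hend := image_le_of_deriv_right_le_deriv_boundary
    (fun t _ ↦ (hline t).continuousAt.continuousWithinAt)
    (fun t _ ↦ (hline t).hasDerivWithinAt) (by simp)
    (fun t _ ↦ (hparabola t).continuousAt.continuousWithinAt)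
    (fun t _ ↦ (hparabola t).hasDerivWithinAt) hslope (Set.right_mem_Icc.2 zero_le_one)
  simpa [d, norm_sub_rev y x] using hend

theorem hasGradientAt_perturbedQuadratic (hh : ∀ x, HasGradientAt h (h' x) x) (x : E) :
    HasGradientAt (perturbedQuadratic μ x₀ h) (μ • (x - x₀) - h' x) x := by
  rw [hasGradientAt_iff_hasFDerivAt]
  refine ((((hasFDerivAt_id x).sub_const x₀).norm_sq.const_mul (μ / 2)).sub
    (hh x).hasFDerivAt).congr_fderiv ?_
  ext y
  simp only [id_eq, map_sub, ContinuousLinearMap.comp_id, sub_apply,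
    smul_apply, coe_innerSL_apply, nsmul_eq_mul, Nat.cast_ofNat, smul_eq_mul,
    InnerProductSpace.toDual_apply_apply, map_smul, sub_left_inj]
  ring

theorem perturbedQuadratic_lower_bound (hh : ∀ x, HasGradientAt h (h' x) x)
    (hκ : ∀ x y, ‖h' x - h' y‖ ≤ κ * ‖x - y‖) (x y : E) :
    perturbedQuadratic μ x₀ h x + ⟪μ • (x - x₀) - h' x, y - x⟫ + (μ - κ) / 2 * ‖x - y‖ ^ 2 ≤
      perturbedQuadratic μ x₀ h y := by
  have hdescent := le_tangent_add_sq_of_lipschitz_gradient hh hκ x y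
  have hexpand : ‖y - x₀‖ ^ 2 = ‖x - x₀‖ ^ 2 + 2 * ⟪x - x₀, y - x⟫ + ‖x - y‖ ^ 2 := by
    rw [← sub_add_sub_cancel' x x₀ y, norm_add_sq_real, norm_sub_rev x y]
  simp only [perturbedQuadratic, inner_sub_left (μ • _), real_inner_smul_left, hexpand]
  linarith

theorem perturbedQuadratic_growth (hh : ∀ x, HasGradientAt h (h' x) x)
    (hκ : ∀ x y, ‖h' x - h' y‖ ≤ κ * ‖x - y‖) (hp : h' p = μ • (p - x₀)) (x : E) :
    perturbedQuadratic μ x₀ h p + (μ - κ) / 2 * ‖x - p‖ ^ 2 ≤ perturbedQuadratic μ x₀ h x := by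
  simpa [hp, norm_sub_rev p x] using perturbedQuadratic_lower_bound (x₀ := x₀) (μ := μ) hh hκ p x

theorem isMinOn_perturbedQuadratic (hκμ : κ ≤ μ) (hh : ∀ x, HasGradientAt h (h' x) x)
    (hκ : ∀ x y, ‖h' x - h' y‖ ≤ κ * ‖x - y‖) (hp : h' p = μ • (p - x₀)) (B : Set E) :
    IsMinOn (perturbedQuadratic μ x₀ h) B p := fun x _ ↦
  (le_add_of_nonneg_right (mul_nonneg (by linarith) (sq_nonneg _))).trans
    (perturbedQuadratic_growth hh hκ hp x)

theorem sq_norm_sub_le_perturbedQuadratic_sub_sInf {B : Set E} (hκμ : κ ≤ μ)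
    (hh : ∀ x, HasGradientAt h (h' x) x) (hκ : ∀ x y, ‖h' x - h' y‖ ≤ κ * ‖x - y‖)
    (hp : h' p = μ • (p - x₀)) (hpB : p ∈ B) (x : E) :
    (μ - κ) / 2 * ‖x - p‖ ^ 2 ≤
      perturbedQuadratic μ x₀ h x - sInf (perturbedQuadratic μ x₀ h '' B) := by
  have hleast : IsLeast (perturbedQuadratic μ x₀ h '' B) (perturbedQuadratic μ x₀ h p) :=
    ⟨Set.mem_image_of_mem _ hpB,
      Set.forall_mem_image.2 (isMinOn_perturbedQuadratic hκμ hh hκ hp B)⟩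
  rw [hleast.csInf_eq]
  linarith [perturbedQuadratic_growth (μ := μ) hh hκ hp x]

theorem gradientWithin_eq_of_hasGradientAt {B : Set E} (hB : Convex ℝ B)
    (hBi : (interior B).Nonempty) {x g : E} (hx : x ∈ B) (hg : HasGradientAt h g x) :
    gradientWithin h B x = g := by
  rw [gradientWithin,
    hg.hasFDerivAt.hasFDerivWithinAt.fderivWithin (uniqueDiffOn_convex hB hBi x hx),
    LinearIsometryEquiv.symm_apply_apply]

theorem perturbedQuadratic_mem_functionClass {n : ℕ} {B : Set (EuclideanSpace ℝ (Fin n))}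
    {x₀ p : EuclideanSpace ℝ (Fin n)} {h : EuclideanSpace ℝ (Fin n) → ℝ}
    {h' : EuclideanSpace ℝ (Fin n) → EuclideanSpace ℝ (Fin n)} (hκ₀ : 0 ≤ κ) (hκμ : κ < μ)
    (hB : Convex ℝ B) (hBi : (interior B).Nonempty) (hh : ∀ x, HasGradientAt h (h' x) x)
    (hκ : ∀ x y, ‖h' x - h' y‖ ≤ κ * ‖x - y‖) (hp : h' p = μ • (p - x₀)) (hpB : p ∈ B) :
    perturbedQuadratic μ x₀ h ∈ functionClass (μ - κ) (μ + κ) B := by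
  have hgrad {x : EuclideanSpace ℝ (Fin n)} (hx : x ∈ B) :
      gradientWithin (perturbedQuadratic μ x₀ h) B x = μ • (x - x₀) - h' x :=
    gradientWithin_eq_of_hasGradientAt hB hBi hx (hasGradientAt_perturbedQuadratic hh x)
  refine ⟨⟨by linarith, fun x _ ↦ ?_, fun x hx y _ ↦ ?_⟩, ⟨by linarith, fun x hx y hy ↦ ?_⟩,
    p, hpB, isMinOn_perturbedQuadratic hκμ.le hh hκ hp B⟩
  · exact (hasGradientAt_perturbedQuadratic hh x).differentiableAt.differentiableWithinAt
  · exact hgrad hx ▸ perturbedQuadratic_lower_bound hh hκ x y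
  · rw [hgrad hx, hgrad hy]
    exact norm_gradient_perturbedQuadratic_sub_le (by linarith) hκ x y

end PerturbedQuadratic

section SineRidge

variable {E : Type*} [NormedAddCommGroup E] [InnerProductSpace ℝ E] {μ κ r : ℝ} {x₀ u p : E}

/-- A bounded wave of width `r` in direction `u`, with steepest point `p`, scaled so that its
gradient is `κ`-Lipschitz when `‖u‖ = 1`. It has height `κ * r ^ 2`, but gradient `(κ * r) • u`
at `p`. -/
def sineRidge (κ r : ℝ) (u p x : E) : ℝ :=
  κ * r ^ 2 * Real.sin (⟪u, x - p⟫ / r)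

theorem abs_sineRidge_le (hκ : 0 ≤ κ) (x : E) : |sineRidge κ r u p x| ≤ κ * r ^ 2 := by
  rw [sineRidge, abs_mul, abs_of_nonneg (by positivity)]
  exact mul_le_of_le_one_right (by positivity) (Real.abs_sin_le_one _)

/-- The gradient of `sineRidge κ r u p`. -/
def sineRidgeGradient (κ r : ℝ) (u p x : E) : E :=
  (κ * r * Real.cos (⟪u, x - p⟫ / r)) • u

theorem hasGradientAt_sineRidge [CompleteSpace E] (hr : r ≠ 0) (x : E) :
    HasGradientAt (sineRidge κ r u p) (sineRidgeGradient κ r u p x) x := by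
  rw [hasGradientAt_iff_hasFDerivAt]
  refine ((((innerSL ℝ u).hasFDerivAt.comp x ((hasFDerivAt_id x).sub_const p)).mul_const
    r⁻¹).sin.const_mul (κ * r ^ 2)).congr_fderiv ?_
  ext y
  simp only [coe_innerSL_apply, id_eq, Function.comp_apply, ContinuousLinearMap.comp_id,
    smul_apply, smul_eq_mul, sineRidgeGradient, div_eq_mul_inv, map_smul,
    InnerProductSpace.toDual_apply_apply]
  field_simp

theorem norm_sineRidgeGradient_sub_le (hκ : 0 ≤ κ) (hr : 0 < r) (hu : ‖u‖ = 1) (x y : E) :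
    ‖sineRidgeGradient κ r u p x - sineRidgeGradient κ r u p y‖ ≤ κ * ‖x - y‖ := by
  have hinner : |⟪u, x - p⟫ / r - ⟪u, y - p⟫ / r| ≤ ‖x - y‖ / r := by
    rw [← sub_div, ← inner_sub_right, sub_sub_sub_cancel_right, abs_div, abs_of_pos hr]
    gcongr
    simpa [hu] using abs_real_inner_le_norm u (x - y)
  calc ‖sineRidgeGradient κ r u p x - sineRidgeGradient κ r u p y‖
      = κ * r * |Real.cos (⟪u, x - p⟫ / r) - Real.cos (⟪u, y - p⟫ / r)| := by
        rw [sineRidgeGradient, sineRidgeGradient, ← sub_smul, ← mul_sub, norm_smul, hu, mul_one,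
          Real.norm_eq_abs, abs_mul, abs_of_nonneg (by positivity)]
    _ ≤ κ * r * (‖x - y‖ / r) := by
        gcongr
        exact (Real.abs_cos_sub_cos_le _ _).trans hinner
    _ = κ * ‖x - y‖ := by field_simp

/-- The hard instances: the quadratic `μ / 2 * ‖x - x₀‖ ^ 2` perturbed by at most `κ * r ^ 2`, with
minimizer moved from `x₀` to `x₀ + (κ * r / μ) • u`. -/
def tiltedQuadratic (μ κ r : ℝ) (x₀ u : E) : E → ℝ :=
  perturbedQuadratic μ x₀ (sineRidge κ r u (x₀ + (κ * r / μ) • u))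

theorem continuous_tiltedQuadratic : Continuous (tiltedQuadratic μ κ r x₀ u) := by
  unfold tiltedQuadratic perturbedQuadratic sineRidge
  fun_prop

theorem abs_tiltedQuadratic_sub_le (hκ : 0 ≤ κ) (x : E) :
    |tiltedQuadratic μ κ r x₀ u x - μ / 2 * ‖x - x₀‖ ^ 2| ≤ κ * r ^ 2 := by
  rw [tiltedQuadratic, perturbedQuadratic, sub_sub_cancel_left, abs_neg]
  exact abs_sineRidge_le hκ x

theorem sineRidgeGradient_minimizer (hμ : μ ≠ 0) :
    sineRidgeGradient κ r u (x₀ + (κ * r / μ) • u) (x₀ + (κ * r / μ) • u) =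
      μ • (x₀ + (κ * r / μ) • u - x₀) := by
  rw [sineRidgeGradient, sub_self, inner_zero_right, zero_div, Real.cos_zero, mul_one,
    add_sub_cancel_left, smul_smul, mul_div_cancel₀ _ hμ]

theorem sq_norm_sub_le_tiltedQuadratic_sub_sInf [CompleteSpace E] {B : Set E} (hκ : 0 ≤ κ)
    (hκμ : κ < μ) (hr : 0 < r) (hu : ‖u‖ = 1) (hmem : x₀ + (κ * r / μ) • u ∈ B) (x : E) :
    (μ - κ) / 2 * ‖x - (x₀ + (κ * r / μ) • u)‖ ^ 2 ≤
      tiltedQuadratic μ κ r x₀ u x - sInf (tiltedQuadratic μ κ r x₀ u '' B) :=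
  sq_norm_sub_le_perturbedQuadratic_sub_sInf hκμ.le (hasGradientAt_sineRidge hr.ne')
    (norm_sineRidgeGradient_sub_le hκ hr hu)
    (sineRidgeGradient_minimizer (hκ.trans_lt hκμ).ne') hmem x

theorem tiltedQuadratic_mem_functionClass {n : ℕ} {B : Set (EuclideanSpace ℝ (Fin n))}
    {x₀ u : EuclideanSpace ℝ (Fin n)} (hκ : 0 ≤ κ) (hκμ : κ < μ) (hr : 0 < r) (hu : ‖u‖ = 1)
    (hB : Convex ℝ B) (hBi : (interior B).Nonempty) (hmem : x₀ + (κ * r / μ) • u ∈ B) :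
    tiltedQuadratic μ κ r x₀ u ∈ functionClass (μ - κ) (μ + κ) B :=
  perturbedQuadratic_mem_functionClass hκ hκμ hB hBi (hasGradientAt_sineRidge hr.ne')
    (norm_sineRidgeGradient_sub_le hκ hr hu)
    (sineRidgeGradient_minimizer (hκ.trans_lt hκμ).ne') hmem

end SineRidge

section SqDominated

variable {α β Ω : Type*} [MeasurableSpace α] [MeasurableSpace β] [MeasurableSpace Ω]

/-- `P` is dominated by `Q` in second moment with constant `C`: the density of `P` with respect
to `Q` has second moment at most `C` under `Q`, that is, the `χ²`-divergence of `P` from `Q` is at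
most `C - 1`. Stated by testing against functions, so that no density has to be mentioned. -/
def SqDominated (C : ℝ≥0∞) (P Q : Measure α) : Prop :=
  ∀ ⦃g : α → ℝ≥0∞⦄, Measurable g → (∫⁻ x, g x ∂P) ^ 2 ≤ C * ∫⁻ x, g x ^ 2 ∂Q

variable {C D : ℝ≥0∞} {P Q : Measure α}

theorem SqDominated.mono (h : SqDominated C P Q) (hCD : C ≤ D) : SqDominated D P Q :=
  fun _ hg ↦ (h hg).trans (by gcongr)

theorem SqDominated.sq_measure_le (h : SqDominated C P Q) {s : Set α} (hs : MeasurableSet s) :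
    P s ^ 2 ≤ C * Q s := by
  have hsq (x : α) : s.indicator (1 : α → ℝ≥0∞) x ^ 2 = s.indicator 1 x := by
    by_cases hx : x ∈ s <;> simp [hx]
  simpa only [hsq, lintegral_indicator_one hs] using h (measurable_one.indicator hs)

theorem SqDominated.measureReal_sq_le [IsFiniteMeasure Q] {c : ℝ} (hc : 0 ≤ c)
    (h : SqDominated (ENNReal.ofReal c) P Q) {s : Set α} (hs : MeasurableSet s) :
    P.real s ^ 2 ≤ c * Q.real s := by
  have hle := ENNReal.toReal_mono (ENNReal.mul_ne_top ENNReal.ofReal_ne_top (measure_ne_top Q s))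
    (h.sq_measure_le hs)
  rwa [ENNReal.toReal_pow, ENNReal.toReal_mul, ENNReal.toReal_ofReal hc] at hle

theorem SqDominated.map (h : SqDominated C P Q) {φ : α → β} (hφ : Measurable φ) :
    SqDominated C (P.map φ) (Q.map φ) := by
  intro g hg
  rw [lintegral_map hg hφ, lintegral_map (hg.pow_const 2) hφ]
  exact h (hg.comp hφ)

theorem sqDominated_withDensity (Q : Measure α) {ρ : α → ℝ≥0∞} (hρ : Measurable ρ) :
    SqDominated (∫⁻ x, ρ x ^ 2 ∂Q) (Q.withDensity ρ) Q := by
  intro g hg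
  have hcauchy := ENNReal.lintegral_mul_le_Lp_mul_Lq Q Real.HolderConjugate.two_two
    hρ.aemeasurable hg.aemeasurable
  rw [lintegral_withDensity_eq_lintegral_mul _ hρ hg]
  simp only [ENNReal.rpow_two] at hcauchy
  refine (pow_le_pow_left' hcauchy 2).trans_eq ?_
  rw [mul_pow, ← ENNReal.rpow_mul_natCast, ← ENNReal.rpow_mul_natCast]
  norm_num

theorem sqDominated_refl (P : Measure α) [IsProbabilityMeasure P] : SqDominated 1 P P := by
  simpa using sqDominated_withDensity P (measurable_one (α := ℝ≥0∞))

section Graph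

variable {ν : Measure Ω} [SFinite ν] {φ : α → Ω → β} {g : α × β → ℝ≥0∞}

theorem measurable_lintegral_map (hφ : Measurable (Function.uncurry φ)) (hg : Measurable g) :
    Measurable fun a ↦ ∫⁻ b, g (a, b) ∂(ν.map (φ a)) := by
  have heq : (fun a ↦ ∫⁻ b, g (a, b) ∂(ν.map (φ a))) = fun a ↦ ∫⁻ ω, g (a, φ a ω) ∂ν :=
    funext fun a ↦ lintegral_map (hg.comp measurable_prodMk_left) (hφ.comp measurable_prodMk_left)
  rw [heq]
  exact (hg.comp (measurable_fst.prodMk hφ)).lintegral_prod_right'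

theorem lintegral_map_graph (P : Measure α) (hφ : Measurable (Function.uncurry φ))
    (hg : Measurable g) :
    ∫⁻ q, g q ∂((P.prod ν).map fun p ↦ (p.1, φ p.1 p.2)) =
      ∫⁻ a, ∫⁻ b, g (a, b) ∂(ν.map (φ a)) ∂P := by
  have hgraph : Measurable fun p : α × Ω ↦ (p.1, φ p.1 p.2) := measurable_fst.prodMk hφ
  rw [lintegral_map hg hgraph,
    lintegral_prod (fun p ↦ g (p.1, φ p.1 p.2)) (hg.comp hgraph).aemeasurable]
  exact lintegral_congr fun a ↦ (lintegral_map (hg.comp measurable_prodMk_left)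
    (hφ.comp measurable_prodMk_left)).symm

end Graph

theorem SqDominated.map_graph (h : SqDominated C P Q) {ν : Measure Ω} [SFinite ν]
    {φ ψ : α → Ω → β} (hφ : Measurable (Function.uncurry φ))
    (hψ : Measurable (Function.uncurry ψ))
    (hD : ∀ a, SqDominated D (ν.map (φ a)) (ν.map (ψ a))) :
    SqDominated (C * D) ((P.prod ν).map fun p ↦ (p.1, φ p.1 p.2))
      ((Q.prod ν).map fun p ↦ (p.1, ψ p.1 p.2)) := by
  intro g hg
  rw [lintegral_map_graph P hφ hg, lintegral_map_graph Q hψ (hg.pow_const 2), mul_assoc,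
    ← lintegral_const_mul D (measurable_lintegral_map hψ (hg.pow_const 2))]
  refine (h (measurable_lintegral_map hφ hg)).trans ?_
  gcongr with a
  exact hD a (hg.comp measurable_prodMk_left)

end SqDominated

section Gaussian

/-- The density of `gaussianReal (m + v * t) v` with respect to `gaussianReal m v`. -/
def gaussianTilt (m : ℝ) (v : ℝ≥0) (t x : ℝ) : ℝ≥0∞ :=
  ENNReal.ofReal (Real.exp (t * (x - m) - v * t ^ 2 / 2))

theorem measurable_gaussianTilt (m : ℝ) (v : ℝ≥0) (t : ℝ) : Measurable (gaussianTilt m v t) := by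
  unfold gaussianTilt
  fun_prop

theorem gaussianReal_withDensity_gaussianTilt (m t : ℝ) {v : ℝ≥0} (hv : v ≠ 0) :
    (gaussianReal m v).withDensity (gaussianTilt m v t) = gaussianReal (m + v * t) v := by
  rw [gaussianReal_of_var_ne_zero _ hv, gaussianReal_of_var_ne_zero _ hv,
    ← withDensity_mul _ (measurable_gaussianPDF _ _) (measurable_gaussianTilt _ _ _)]
  congr 1 with x
  have hexp : Real.exp (-(x - m) ^ 2 / (2 * v)) * Real.exp (t * (x - m) - v * t ^ 2 / 2) =
      Real.exp (-(x - (m + v * t)) ^ 2 / (2 * v)) := by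
    rw [← Real.exp_add]
    congr 1
    field_simp
    ring
  rw [Pi.mul_apply, gaussianPDF, gaussianPDF, gaussianTilt,
    ← ENNReal.ofReal_mul (gaussianPDFReal_nonneg _ _ _), gaussianPDFReal, gaussianPDFReal,
    mul_assoc, hexp]

theorem gaussianTilt_sq (m : ℝ) (v : ℝ≥0) (t x : ℝ) :
    gaussianTilt m v t x ^ 2 =
      ENNReal.ofReal (Real.exp (v * t ^ 2)) * gaussianTilt m v (2 * t) x := by
  rw [gaussianTilt, gaussianTilt, ← ENNReal.ofReal_pow (Real.exp_pos _).le,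
    ← ENNReal.ofReal_mul (Real.exp_pos _).le, ← Real.exp_nat_mul, ← Real.exp_add]
  congr 2
  push_cast
  ring

theorem lintegral_gaussianTilt_sq (m t : ℝ) {v : ℝ≥0} (hv : v ≠ 0) :
    ∫⁻ x, gaussianTilt m v t x ^ 2 ∂gaussianReal m v = ENNReal.ofReal (Real.exp (v * t ^ 2)) := by
  have hone : ∫⁻ x, gaussianTilt m v (2 * t) x ∂gaussianReal m v = 1 := by
    rw [← setLIntegral_univ, ← withDensity_apply _ MeasurableSet.univ,
      gaussianReal_withDensity_gaussianTilt m _ hv, measure_univ]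
  simp only [gaussianTilt_sq]
  rw [lintegral_const_mul _ (measurable_gaussianTilt _ _ _), hone, mul_one]

theorem sqDominated_gaussianReal (m₁ m₂ : ℝ) {v : ℝ≥0} (hv : v ≠ 0) :
    SqDominated (ENNReal.ofReal (Real.exp ((m₁ - m₂) ^ 2 / v))) (gaussianReal m₁ v)
      (gaussianReal m₂ v) := by
  have hmean : m₂ + v * ((m₁ - m₂) / v) = m₁ := by field_simp; ring
  have hconst : v * ((m₁ - m₂) / v) ^ 2 = (m₁ - m₂) ^ 2 / v := by field_simp
  have h := sqDominated_withDensity (gaussianReal m₂ v)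
    (measurable_gaussianTilt m₂ v ((m₁ - m₂) / v))
  rwa [lintegral_gaussianTilt_sq m₂ _ hv, gaussianReal_withDensity_gaussianTilt m₂ _ hv, hmean,
    hconst] at h

theorem isNoiseLaw_gaussianReal (σ : ℝ) :
    IsNoiseLaw σ (gaussianReal 0 (σ ^ 2).toNNReal) where
  isProbabilityMeasure := inferInstance
  memLp := memLp_id_gaussianReal 2
  mean := integral_id_gaussianReal
  second_moment := by
    rw [← variance_of_integral_eq_zero (by fun_prop) integral_id_gaussianReal,
      variance_fun_id_gaussianReal, Real.coe_toNNReal _ (sq_nonneg σ)]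

end Gaussian

section Noise

variable {ι α β : Type*} [Fintype ι] [DecidableEq ι] {X : ι → Type*}
  [∀ i, MeasurableSpace (X i)] [MeasurableSpace α] [MeasurableSpace β]

theorem lintegral_pi_eq_lintegral_update (ν : ∀ i, Measure (X i))
    [∀ i, IsProbabilityMeasure (ν i)] (i : ι) {G : (∀ i, X i) → ℝ≥0∞} (hG : Measurable G) :
    ∫⁻ w, G w ∂(Measure.pi ν) = ∫⁻ w, ∫⁻ t, G (Function.update w i t) ∂(ν i) ∂(Measure.pi ν) := by
  simp only [← congrFun (lmarginal_singleton (μ := ν) G i)]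
  refine lintegral_eq_of_lmarginal_eq {i} hG (hG.lmarginal ν) ?_
  ext w
  rw [lmarginal_singleton (∫⋯∫⁻_{i}, G ∂ν)]
  simp [lmarginal_update_of_mem ν (Finset.mem_singleton_self i)]

theorem map_prod_pi_eq_prod (P : Measure α) (ν : ∀ i, Measure (X i))
    [∀ i, IsProbabilityMeasure (ν i)] (i : ι) {F : α × (∀ i, X i) → β} (hF : Measurable F)
    (hFi : ∀ a w t, F (a, Function.update w i t) = F (a, w)) :
    (P.prod (Measure.pi ν)).map (fun p ↦ (F p, p.2 i)) =
      ((P.prod (Measure.pi ν)).map F).prod (ν i) := by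
  refine Measure.ext_of_lintegral _ fun g hg ↦ ?_
  have hpair : Measurable fun p : α × (∀ i, X i) ↦ g (F p, p.2 i) :=
    hg.comp (hF.prodMk ((measurable_pi_apply i).comp measurable_snd))
  have hinner : Measurable fun b ↦ ∫⁻ t, g (b, t) ∂(ν i) := hg.lintegral_prod_right'
  have hinnerF : Measurable fun p ↦ ∫⁻ t, g (F p, t) ∂(ν i) := hinner.comp hF
  rw [lintegral_map hg (by fun_prop), lintegral_prod g hg.aemeasurable, lintegral_map hinner hF,
    lintegral_prod _ hpair.aemeasurable, lintegral_prod _ hinnerF.aemeasurable]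
  refine lintegral_congr fun a ↦ ?_
  refine (lintegral_pi_eq_lintegral_update ν i (hpair.comp measurable_prodMk_left)).trans ?_
  simp [hFi]

end Noise

section Transcript

/-- Appends the next answer to a transcript, i.e. to a seed together with the answers so far. -/
def snocAnswer {S : Type*} {k : ℕ} (q : (S × (Fin k → ℝ)) × ℝ) : S × (Fin (k + 1) → ℝ) :=
  (q.1.1, Fin.snoc q.1.2 q.2)

theorem measurable_snocAnswer {S : Type*} [MeasurableSpace S] {k : ℕ} :
    Measurable (snocAnswer : (S × (Fin k → ℝ)) × ℝ → S × (Fin (k + 1) → ℝ)) := by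
  refine (measurable_fst.comp measurable_fst).prodMk (measurable_pi_iff.2 fun i ↦ ?_)
  cases i using Fin.lastCases with
  | last => simpa using measurable_snd
  | cast j =>
    simp only [Fin.snoc_castSucc]
    fun_prop

variable {n : ℕ} {B : Set (EuclideanSpace ℝ (Fin n))} {T : ℕ} (A : Method.{u} B T)
  {f g : EuclideanSpace ℝ (Fin n) → ℝ}

/-- The seed and the first `k` answers, as a function of the seed and the noise. -/
def Method.transcript (f : EuclideanSpace ℝ (Fin n) → ℝ) (k : ℕ) (hk : k ≤ T)
    (p : A.Seed × (Fin T → ℝ)) : A.Seed × (Fin k → ℝ) :=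
  (p.1, A.answers f p.1 p.2 k hk)

/-- The answer to the `k`-th query, as a function of the transcript before it and its noise. -/
def Method.nextAnswer (f : EuclideanSpace ℝ (Fin n) → ℝ) (k : Fin T) (a : A.Seed × (Fin k → ℝ))
    (t : ℝ) : ℝ :=
  f (A.query k a) + t

theorem Method.measurable_nextAnswer (hf : Measurable f) (k : Fin T) :
    Measurable (Function.uncurry (A.nextAnswer f k)) :=
  (hf.comp (measurable_subtype_coe.comp ((A.measurable_query k).comp measurable_fst))).add
    measurable_snd

theorem Method.transcript_succ (f : EuclideanSpace ℝ (Fin n) → ℝ) (k : ℕ) (hk : k + 1 ≤ T)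
    (p : A.Seed × (Fin T → ℝ)) :
    A.transcript f (k + 1) hk p =
      snocAnswer (A.transcript f k (Nat.le_of_succ_le hk) p,
        A.nextAnswer f ⟨k, hk⟩ (A.transcript f k (Nat.le_of_succ_le hk) p) (p.2 ⟨k, hk⟩)) :=
  rfl

theorem Method.measurable_transcript (hf : Measurable f) (k : ℕ) (hk : k ≤ T) :
    Measurable (A.transcript f k hk) := by
  induction k with
  | zero => exact measurable_fst.prodMk (measurable_pi_iff.2 fun i ↦ i.elim0)
  | succ k ih =>
    have hprev := ih (Nat.le_of_succ_le hk)
    have hnoise : Measurable fun p : A.Seed × (Fin T → ℝ) ↦ p.2 ⟨k, hk⟩ := by fun_prop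
    exact measurable_snocAnswer.comp
      (hprev.prodMk ((A.measurable_nextAnswer hf ⟨k, hk⟩).comp (hprev.prodMk hnoise)))

theorem Method.transcript_update_of_le (f : EuclideanSpace ℝ (Fin n) → ℝ) (s : A.Seed)
    (w : Fin T → ℝ) (i : Fin T) (t : ℝ) {k : ℕ} (hk : k ≤ T) (hki : k ≤ i) :
    A.transcript f k hk (s, Function.update w i t) = A.transcript f k hk (s, w) := by
  induction k with
  | zero => rfl
  | succ k ih =>
    have hne : (⟨k, hk⟩ : Fin T) ≠ i := Fin.ne_of_lt hki
    rw [A.transcript_succ, A.transcript_succ, ih _ (Nat.le_of_succ_le hki)]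
    simp only [Function.update_of_ne hne]

/-- The law of the seed and the first `k` answers of the oracle for `f` with noise law `ν`. -/
def Method.transcriptLaw (f : EuclideanSpace ℝ (Fin n) → ℝ) (ν : Measure ℝ) (k : ℕ) (hk : k ≤ T) :
    Measure (A.Seed × (Fin k → ℝ)) :=
  (A.seedLaw.prod (Measure.pi fun _ : Fin T ↦ ν)).map (A.transcript f k hk)

theorem Method.isProbabilityMeasure_transcriptLaw (hf : Measurable f) (ν : Measure ℝ)
    [IsProbabilityMeasure ν] (k : ℕ) (hk : k ≤ T) :
    IsProbabilityMeasure (A.transcriptLaw f ν k hk) :=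
  Measure.isProbabilityMeasure_map (A.measurable_transcript hf k hk).aemeasurable

theorem Method.transcriptLaw_succ (hf : Measurable f) (ν : Measure ℝ) [IsProbabilityMeasure ν]
    (k : ℕ) (hk : k + 1 ≤ T) :
    A.transcriptLaw f ν (k + 1) hk =
      (((A.transcriptLaw f ν k (Nat.le_of_succ_le hk)).prod ν).map
        fun q ↦ (q.1, A.nextAnswer f ⟨k, hk⟩ q.1 q.2)).map snocAnswer := by
  have hprev := A.measurable_transcript hf k (Nat.le_of_succ_le hk)
  have hnoise : Measurable fun p : A.Seed × (Fin T → ℝ) ↦ p.2 ⟨k, hk⟩ := by fun_prop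
  have hgraph : Measurable fun q : (A.Seed × (Fin k → ℝ)) × ℝ ↦
      (q.1, A.nextAnswer f ⟨k, hk⟩ q.1 q.2) :=
    measurable_fst.prodMk (A.measurable_nextAnswer hf ⟨k, hk⟩)
  have hindep := map_prod_pi_eq_prod A.seedLaw (fun _ : Fin T ↦ ν) ⟨k, hk⟩ hprev
    fun s w t ↦ A.transcript_update_of_le f s w ⟨k, hk⟩ t _ le_rfl
  rw [Method.transcriptLaw, Method.transcriptLaw, ← hindep, Measure.map_map hgraph
    (hprev.prodMk hnoise), Measure.map_map measurable_snocAnswer (hgraph.comp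
    (hprev.prodMk hnoise))]
  rfl

theorem sqDominated_map_add_gaussianReal {x y Δ : ℝ} (hxy : |x - y| ≤ Δ) {v : ℝ≥0} (hv : v ≠ 0) :
    SqDominated (ENNReal.ofReal (Real.exp (Δ ^ 2 / v))) ((gaussianReal 0 v).map (x + ·))
      ((gaussianReal 0 v).map (y + ·)) := by
  rw [gaussianReal_map_const_add, gaussianReal_map_const_add, zero_add, zero_add]
  refine (sqDominated_gaussianReal x y hv).mono ?_
  gcongr ENNReal.ofReal (Real.exp (?_ / _))
  exact sq_le_sq.2 (hxy.trans (le_abs_self Δ))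

theorem Method.sqDominated_transcriptLaw (hf : Measurable f) (hg : Measurable g) {Δ : ℝ}
    (hfg : ∀ x, |f x - g x| ≤ Δ) {v : ℝ≥0} (hv : v ≠ 0) (k : ℕ) (hk : k ≤ T) :
    SqDominated (ENNReal.ofReal (Real.exp (Δ ^ 2 / v)) ^ k)
      (A.transcriptLaw f (gaussianReal 0 v) k hk) (A.transcriptLaw g (gaussianReal 0 v) k hk) := by
  have hprob (f : EuclideanSpace ℝ (Fin n) → ℝ) (hf : Measurable f) :=
    A.isProbabilityMeasure_transcriptLaw hf (gaussianReal 0 v)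
  induction k with
  | zero =>
    have := hprob g hg 0 hk
    rw [pow_zero]
    exact sqDominated_refl (A.transcriptLaw g _ 0 hk)
  | succ k ih =>
    have := hprob f hf k (Nat.le_of_succ_le hk)
    have := hprob g hg k (Nat.le_of_succ_le hk)
    rw [A.transcriptLaw_succ hf, A.transcriptLaw_succ hg, pow_succ]
    exact ((ih _).map_graph (A.measurable_nextAnswer hf ⟨k, hk⟩)
      (A.measurable_nextAnswer hg ⟨k, hk⟩)
      fun a ↦ sqDominated_map_add_gaussianReal (hfg _) hv).map measurable_snocAnswer

theorem Method.measurable_estimate (hf : Measurable f) :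
    Measurable fun p : A.Seed × (Fin T → ℝ) ↦ A.estimate f p.1 p.2 :=
  measurable_subtype_coe.comp
    (A.measurable_output.comp (A.measurable_transcript hf T le_rfl))

/-- The law of the estimate of `A` for the oracle for `f` with noise law `ν`. -/
def Method.estimateLaw (f : EuclideanSpace ℝ (Fin n) → ℝ) (ν : Measure ℝ) :
    Measure (EuclideanSpace ℝ (Fin n)) :=
  (A.seedLaw.prod (Measure.pi fun _ : Fin T ↦ ν)).map fun p ↦ A.estimate f p.1 p.2

theorem Method.isProbabilityMeasure_estimateLaw (hf : Measurable f) (ν : Measure ℝ)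
    [IsProbabilityMeasure ν] : IsProbabilityMeasure (A.estimateLaw f ν) :=
  Measure.isProbabilityMeasure_map (A.measurable_estimate hf).aemeasurable

theorem Method.estimateLaw_eq_map_transcriptLaw (hf : Measurable f) (ν : Measure ℝ) :
    A.estimateLaw f ν = (A.transcriptLaw f ν T le_rfl).map
      fun a ↦ (A.output a : EuclideanSpace ℝ (Fin n)) :=
  (Measure.map_map (measurable_subtype_coe.comp A.measurable_output)
    (A.measurable_transcript hf T le_rfl)).symm

theorem Method.sqDominated_estimateLaw (hf : Measurable f) (hg : Measurable g) {Δ : ℝ}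
    (hfg : ∀ x, |f x - g x| ≤ Δ) {v : ℝ≥0} (hv : v ≠ 0) :
    SqDominated (ENNReal.ofReal (Real.exp (T * Δ ^ 2 / v)))
      (A.estimateLaw f (gaussianReal 0 v)) (A.estimateLaw g (gaussianReal 0 v)) := by
  have hconst : ENNReal.ofReal (Real.exp (T * Δ ^ 2 / v)) =
      ENNReal.ofReal (Real.exp (Δ ^ 2 / v)) ^ T := by
    rw [← ENNReal.ofReal_pow (Real.exp_pos _).le, ← Real.exp_nat_mul, mul_div_assoc]
  rw [hconst, A.estimateLaw_eq_map_transcriptLaw hf, A.estimateLaw_eq_map_transcriptLaw hg]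
  exact (A.sqDominated_transcriptLaw hf hg hfg hv T le_rfl).map
    (measurable_subtype_coe.comp A.measurable_output)

theorem Method.expectedError_eq_lintegral_estimateLaw (hf : Measurable f) (ν : Measure ℝ) :
    A.expectedError f ν = ∫⁻ x, ENNReal.ofReal (f x - sInf (f '' B)) ∂(A.estimateLaw f ν) :=
  (lintegral_map (f := fun x ↦ ENNReal.ofReal (f x - sInf (f '' B))) (by fun_prop)
    (A.measurable_estimate hf)).symm

end Transcript

section SignVectors

variable {ι : Type*} [Fintype ι]

/-- The unit vector whose coordinates are `± 1 / √(card ι)`, with signs given by `b`. -/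
def signVector (b : ι → ℤˣ) : EuclideanSpace ℝ ι :=
  WithLp.toLp 2 fun i ↦ ((b i : ℤ) : ℝ) / √(Fintype.card ι)

theorem norm_signVector [Nonempty ι] (b : ι → ℤˣ) : ‖signVector b‖ = 1 := by
  have hsq (u : ℤˣ) : ((u : ℤ) : ℝ) ^ 2 = 1 := by
    rcases Int.units_eq_one_or u with rfl | rfl <;> norm_num
  rw [EuclideanSpace.norm_eq, Real.sqrt_eq_one]
  simp [signVector, div_pow, hsq]

theorem card_mul_inner_signVector (b : ι → ℤˣ) (x : EuclideanSpace ℝ ι) :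
    Fintype.card ι * ⟪signVector b, x⟫ = ∑ i, ((b i : ℤ) : ℝ) * (√(Fintype.card ι) * x i) := by
  rw [PiLp.inner_apply, Finset.mul_sum]
  refine Finset.sum_congr rfl fun i _ ↦ ?_
  simp only [signVector, RCLike.inner_apply, conj_trivial]
  linear_combination (b i : ℤ) * x i * Real.div_sqrt (x := Fintype.card ι)

variable [DecidableEq ι]

theorem sum_exp_sign_smul_le (t : ι → ℝ) :
    ∑ b : ι → ℤˣ, Real.exp (∑ i, ((b i : ℤ) : ℝ) * t i) ≤
      2 ^ Fintype.card ι * Real.exp (∑ i, t i ^ 2 / 2) :=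
  calc ∑ b : ι → ℤˣ, Real.exp (∑ i, ((b i : ℤ) : ℝ) * t i)
      = ∏ i, ∑ u : ℤˣ, Real.exp (((u : ℤ) : ℝ) * t i) := by
        simp only [Real.exp_sum, Finset.prod_univ_sum, Fintype.piFinset_univ]
    _ = ∏ i, 2 * Real.cosh (t i) := by
        refine Finset.prod_congr rfl fun i _ ↦ ?_
        rw [Real.cosh_eq, mul_div_cancel₀ _ two_ne_zero]
        simp [UnitsInt.univ]
    _ ≤ ∏ i, 2 * Real.exp (t i ^ 2 / 2) := by
        gcongr with i
        exact Real.cosh_le_exp_half_sq (t i)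
    _ = 2 ^ Fintype.card ι * Real.exp (∑ i, t i ^ 2 / 2) := by
        rw [Finset.prod_mul_distrib, Real.exp_sum, Finset.prod_const, Finset.card_univ]

theorem sum_exp_inner_signVector_le (x : EuclideanSpace ℝ ι) :
    ∑ b : ι → ℤˣ, Real.exp (Fintype.card ι * ⟪signVector b, x⟫) ≤
      2 ^ Fintype.card ι * Real.exp (Fintype.card ι * ‖x‖ ^ 2 / 2) := by
  simp only [card_mul_inner_signVector]
  refine (sum_exp_sign_smul_le _).trans_eq ?_
  simp only [mul_pow, Real.sq_sqrt (Nat.cast_nonneg _), EuclideanSpace.real_norm_sq_eq,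
    Finset.mul_sum, Finset.sum_div]

open scoped Classical in
theorem card_filter_mem_ball_signVector_le [Nonempty ι] (x : EuclideanSpace ℝ ι) (ρ : ℝ) :
    ((Finset.univ.filter fun b : ι → ℤˣ ↦ x ∈ ball (signVector b) ρ).card : ℝ) ≤
      Real.exp (-(Fintype.card ι * (1 - ρ ^ 2) / 2)) * 2 ^ Fintype.card ι := by
  set S := Finset.univ.filter fun b : ι → ℤˣ ↦ x ∈ ball (signVector b) ρ
  -- Chernoff: vectors close to `x` have a large inner product with `x`, which few of them can have.
  have hexp : ∀ b ∈ S, Real.exp (Fintype.card ι * (‖x‖ ^ 2 + 1 - ρ ^ 2) / 2) ≤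
      Real.exp (Fintype.card ι * ⟪signVector b, x⟫) := by
    intro b hb
    have hdist : ‖x - signVector b‖ < ρ := mem_ball_iff_norm.1 (Finset.mem_filter.1 hb).2
    have hpolar := norm_sub_sq_real x (signVector b)
    rw [norm_signVector, real_inner_comm] at hpolar
    have hinner : ‖x‖ ^ 2 + 1 - ρ ^ 2 ≤ 2 * ⟪signVector b, x⟫ := by
      nlinarith [norm_nonneg (x - signVector b)]
    rw [mul_div_assoc]
    gcongr
    linarith
  have hsum : S.card * Real.exp (Fintype.card ι * (‖x‖ ^ 2 + 1 - ρ ^ 2) / 2) ≤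
      2 ^ Fintype.card ι * Real.exp (Fintype.card ι * ‖x‖ ^ 2 / 2) := by
    rw [← nsmul_eq_mul]
    exact (Finset.card_nsmul_le_sum S _ _ hexp).trans
      ((Finset.sum_le_univ_sum_of_nonneg fun b ↦ (Real.exp_pos _).le).trans
        (sum_exp_inner_signVector_le x))
  refine (le_div_iff₀ (Real.exp_pos _)).2 hsum |>.trans_eq ?_
  rw [mul_div_assoc, ← Real.exp_sub, mul_comm]
  ring_nf

end SignVectors

section Pigeonhole

open scoped Classical in
theorem sum_measureReal_le_of_card_filter_mem_le {Ω β : Type*} [MeasurableSpace Ω] [Fintype β]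
    (P : Measure Ω) [IsProbabilityMeasure P] {E : β → Set Ω} (hE : ∀ b, MeasurableSet (E b))
    {K : ℝ} (hK : ∀ x, ((Finset.univ.filter fun b ↦ x ∈ E b).card : ℝ) ≤ K) :
    ∑ b, P.real (E b) ≤ K := by
  have hint (b : β) : Integrable ((E b).indicator (1 : Ω → ℝ)) P :=
    (integrable_const (1 : ℝ)).indicator (hE b)
  calc ∑ b, P.real (E b) = ∫ x, ∑ b, (E b).indicator 1 x ∂P := by
        rw [integral_finsetSum _ fun b _ ↦ hint b]
        simp only [integral_indicator_one (hE _)]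
    _ ≤ ∫ _, K ∂P := by
        refine integral_mono (integrable_finsetSum _ fun b _ ↦ hint b) (integrable_const K)
          fun x ↦ le_of_eq_of_le ?_ (hK x)
        simp [Set.indicator_apply]
    _ = K := by simp

variable {ι : Type*} [Fintype ι] [Nonempty ι]

theorem exists_measureReal_ball_signVector_le (P : Measure (EuclideanSpace ℝ ι))
    [IsProbabilityMeasure P] (ρ : ℝ) :
    ∃ b : ι → ℤˣ, P.real (ball (signVector b) ρ) ≤
      Real.exp (-(Fintype.card ι * (1 - ρ ^ 2) / 2)) := by
  classical
  have hsum := sum_measureReal_le_of_card_filter_mem_le P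
    (fun b : ι → ℤˣ ↦ measurableSet_ball (x := signVector b)) fun x ↦
      card_filter_mem_ball_signVector_le x ρ
  have hconst : Real.exp (-(Fintype.card ι * (1 - ρ ^ 2) / 2)) * 2 ^ Fintype.card ι =
      ∑ _b : ι → ℤˣ, Real.exp (-(Fintype.card ι * (1 - ρ ^ 2) / 2)) := by
    simp [mul_comm]
  obtain ⟨b, -, hb⟩ := Finset.exists_le_of_sum_le Finset.univ_nonempty (hsum.trans_eq hconst)
  exact ⟨b, hb⟩

theorem exists_measureReal_ball_add_smul_signVector_le (P : Measure (EuclideanSpace ℝ ι))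
    [IsProbabilityMeasure P] (x₀ : EuclideanSpace ℝ ι) {a : ℝ} (ha : 0 < a) (ρ : ℝ) :
    ∃ b : ι → ℤˣ, P.real (ball (x₀ + a • signVector b) (a * ρ)) ≤
      Real.exp (-(Fintype.card ι * (1 - ρ ^ 2) / 2)) := by
  have hφ : Measurable fun x ↦ a⁻¹ • (x - x₀) := by fun_prop
  have := Measure.isProbabilityMeasure_map (μ := P) hφ.aemeasurable
  obtain ⟨b, hb⟩ := exists_measureReal_ball_signVector_le (P.map fun x ↦ a⁻¹ • (x - x₀)) ρ
  refine ⟨b, le_of_eq_of_le ?_ hb⟩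
  rw [map_measureReal_apply hφ measurableSet_ball]
  congr 1
  ext x
  have hscale : x - (x₀ + a • signVector b) = a • (a⁻¹ • (x - x₀) - signVector b) := by
    rw [smul_sub, smul_inv_smul₀ ha.ne', sub_add_eq_sub_sub]
  rw [Set.mem_preimage, mem_ball_iff_norm, mem_ball_iff_norm, hscale, norm_smul,
    Real.norm_of_nonneg ha.le, mul_lt_mul_iff_right₀ ha]

end Pigeonhole

section LowerBound

theorem eventually_closedBall_subset {α X : Type*} [PseudoMetricSpace X] {s : Set X} {x : X}
    (hx : x ∈ interior s) {l : Filter α} {ρ : α → ℝ} (hρ : Tendsto ρ l (nhds 0)) :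
    ∀ᶠ a in l, closedBall x (ρ a) ⊆ s := by
  obtain ⟨ε, hε, hsub⟩ := nhds_basis_closedBall.mem_iff.1 (mem_interior_iff_mem_nhds.1 hx)
  filter_upwards [hρ.eventually_le_const hε] with a ha
  exact (closedBall_subset_closedBall ha).trans hsub

theorem ofReal_mul_le_lintegral_of_measureReal_le {α : Type*} [MeasurableSpace α] {P : Measure α}
    [IsProbabilityMeasure P] {s : Set α} (hs : MeasurableSet s) {F : α → ℝ} {δ ε : ℝ}
    (hδ : 0 ≤ δ) (hF : ∀ x ∉ s, δ ≤ F x) (hsε : P.real s ≤ 1 - ε) :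
    ENNReal.ofReal (δ * ε) ≤ ∫⁻ x, ENNReal.ofReal (F x) ∂P :=
  calc ENNReal.ofReal (δ * ε) ≤ ENNReal.ofReal δ * P sᶜ := by
        rw [ENNReal.ofReal_mul hδ, ← ofReal_measureReal, probReal_compl_eq_one_sub hs]
        gcongr
        linarith
    _ = ∫⁻ _ in sᶜ, ENNReal.ofReal δ ∂P := (setLIntegral_const _ _).symm
    _ ≤ ∫⁻ x in sᶜ, ENNReal.ofReal (F x) ∂P :=
        setLIntegral_mono' hs.compl fun x hx ↦ ENNReal.ofReal_le_ofReal (hF x hx)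
    _ ≤ ∫⁻ x, ENNReal.ofReal (F x) ∂P := setLIntegral_le_lintegral _ _

variable {n T : ℕ} {B : Set (EuclideanSpace ℝ (Fin n))} {μ κ r : ℝ}
  {x₀ : EuclideanSpace ℝ (Fin n)}

theorem Method.exists_measureReal_estimateLaw_ball_le [NeZero n] (A : Method.{u} B T)
    (hκ : 0 < κ) (hμ : 0 < μ) (hr : 0 < r) {v : ℝ≥0} (hv : v ≠ 0)
    (hT : T * (κ * r ^ 2) ^ 2 / v ≤ n / 8) (x₀ : EuclideanSpace ℝ (Fin n)) :
    ∃ b : Fin n → ℤˣ, (A.estimateLaw (tiltedQuadratic μ κ r x₀ (signVector b))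
      (gaussianReal 0 v)).real (ball (x₀ + (κ * r / μ) • signVector b) (κ * r / μ * (1 / 2))) ≤
        8 / 9 := by
  have hquad : Measurable fun x : EuclideanSpace ℝ (Fin n) ↦ μ / 2 * ‖x - x₀‖ ^ 2 := by fun_prop
  have := A.isProbabilityMeasure_estimateLaw hquad (gaussianReal 0 v)
  set Q := A.estimateLaw (fun x ↦ μ / 2 * ‖x - x₀‖ ^ 2) (gaussianReal 0 v)
  obtain ⟨b, hb⟩ := exists_measureReal_ball_add_smul_signVector_le Q x₀
    (show 0 < κ * r / μ by positivity) (1 / 2)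
  refine ⟨b, ?_⟩
  have hdom := A.sqDominated_estimateLaw continuous_tiltedQuadratic.measurable hquad
    (abs_tiltedQuadratic_sub_le (r := r) (u := signVector b) hκ.le) hv
  set P := A.estimateLaw (tiltedQuadratic μ κ r x₀ (signVector b)) (gaussianReal 0 v)
  set S := ball (x₀ + (κ * r / μ) • signVector b) (κ * r / μ * (1 / 2))
  -- Changing the measure costs `n / 8` of the exponent `3 * n / 8`; the root halves the rest.
  have hsq : P.real S ^ 2 ≤ Real.exp (-(n / 8)) ^ 2 :=
    calc P.real S ^ 2 ≤ Real.exp (T * (κ * r ^ 2) ^ 2 / v) * Q.real S :=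
          hdom.measureReal_sq_le (Real.exp_pos _).le measurableSet_ball
      _ ≤ Real.exp (n / 8) * Real.exp (-(n * (1 - (1 / 2) ^ 2) / 2)) := by
          rw [Fintype.card_fin] at hb
          gcongr
      _ = Real.exp (-(n / 8)) ^ 2 := by
          rw [← Real.exp_add, ← Real.exp_nat_mul]
          ring_nf
  have hexp : Real.exp (-(n / 8)) ≤ 8 / 9 := by
    have hn : (1 : ℝ) ≤ n := by exact_mod_cast NeZero.one_le
    rw [Real.exp_neg, inv_le_comm₀ (Real.exp_pos _) (by norm_num)]
    linarith [Real.add_one_le_exp (n / 8 : ℝ)]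
  exact (le_of_sq_le_sq hsq (Real.exp_pos _).le).trans hexp

theorem Method.exists_le_expectedError_tiltedQuadratic [NeZero n] (A : Method.{u} B T)
    (hκ : 0 < κ) (hκμ : κ < μ) (hr : 0 < r) {v : ℝ≥0} (hv : v ≠ 0)
    (hT : T * (κ * r ^ 2) ^ 2 / v ≤ n / 8)
    (hB : ∀ b : Fin n → ℤˣ, x₀ + (κ * r / μ) • signVector b ∈ B) :
    ∃ b : Fin n → ℤˣ, ENNReal.ofReal ((μ - κ) / 2 * (κ * r / μ * (1 / 2)) ^ 2 * (1 / 9)) ≤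
      A.expectedError (tiltedQuadratic μ κ r x₀ (signVector b)) (gaussianReal 0 v) := by
  have hμ : 0 < μ := hκ.trans hκμ
  obtain ⟨b, hb⟩ := A.exists_measureReal_estimateLaw_ball_le hκ hμ hr hv hT x₀
  have hmeas : Measurable (tiltedQuadratic μ κ r x₀ (signVector b)) :=
    continuous_tiltedQuadratic.measurable
  have := A.isProbabilityMeasure_estimateLaw hmeas (gaussianReal 0 v)
  refine ⟨b, ?_⟩
  rw [A.expectedError_eq_lintegral_estimateLaw hmeas]
  have : 0 ≤ (μ - κ) / 2 := by linarith
  refine ofReal_mul_le_lintegral_of_measureReal_le measurableSet_ball (by positivity)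
    (fun x hx ↦ ?_) (hb.trans (by norm_num))
  refine le_trans ?_ (sq_norm_sub_le_tiltedQuadratic_sub_sInf hκ.le hκμ hr (norm_signVector b)
    (hB b) x)
  gcongr
  rwa [mem_ball_iff_norm, not_lt] at hx

theorem ofReal_le_minimaxError [NeZero n] {σ : ℝ} (hκ : 0 < κ) (hκμ : κ < μ) (hr : 0 < r)
    (hσ : σ ≠ 0) (hT : T * (κ * r ^ 2) ^ 2 / σ ^ 2 ≤ n / 8) (hB : Convex ℝ B)
    (hBi : (interior B).Nonempty) (hball : closedBall x₀ (κ * r / μ) ⊆ B) :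
    ENNReal.ofReal ((μ - κ) / 2 * (κ * r / μ * (1 / 2)) ^ 2 * (1 / 9)) ≤
      minimaxError.{u} (μ - κ) (μ + κ) σ B T := by
  have hμ : 0 < μ := hκ.trans hκμ
  have hminimizer (b : Fin n → ℤˣ) : x₀ + (κ * r / μ) • signVector b ∈ B := hball <| by
    rw [mem_closedBall_iff_norm, add_sub_cancel_left, norm_smul, norm_signVector, mul_one,
      Real.norm_of_nonneg (by positivity)]
  have hv : (σ ^ 2).toNNReal ≠ 0 := (Real.toNNReal_pos.2 (by positivity)).ne'
  refine le_iInf fun A ↦ ?_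
  obtain ⟨b, hb⟩ := A.exists_le_expectedError_tiltedQuadratic hκ hκμ hr hv
    (by rwa [Real.coe_toNNReal _ (sq_nonneg σ)]) hminimizer
  exact hb.trans <| le_iSup₂_of_le _
    (tiltedQuadratic_mem_functionClass hκ.le hκμ hr (norm_signVector b) hB hBi (hminimizer b)) <|
    le_iSup₂_of_le _ (isNoiseLaw_gaussianReal σ) le_rfl

end LowerBound

end DFO

end

open DFO in
theorem theorem3_general (τ L : ℝ) (hτ : 0 < τ) (hτL : τ < L) :
    ∃ c : ℝ, 0 < c ∧
      ∀ (n : ℕ) (B : Set (EuclideanSpace ℝ (Fin n))), Convex ℝ B → (interior B).Nonempty →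
      ∀ (σ : ℝ), 0 < σ →
      ∀ᶠ T : ℕ in atTop,
        ENNReal.ofReal (c * √(n * σ ^ 2 / T)) ≤ DFO.minimaxError.{u} τ L σ B T := by
  obtain ⟨μ, κ, rfl, rfl⟩ : ∃ μ κ, τ = μ - κ ∧ L = μ + κ :=
    ⟨(L + τ) / 2, (L - τ) / 2, by ring, by ring⟩
  have hκ : 0 < κ := by linarith
  have hμ : 0 < μ := by linarith
  refine ⟨(μ - κ) * κ / (216 * μ ^ 2), by positivity, fun n B hB hBi σ hσ ↦ ?_⟩
  rcases n.eq_zero_or_pos with rfl | hn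
  · simp
  have : NeZero n := ⟨hn.ne'⟩
  obtain ⟨x₀, hx₀⟩ := hBi
  set r : ℕ → ℝ := fun T ↦ √(√(n * σ ^ 2 / T) / (3 * κ)) with hr
  have hlim : Tendsto (fun T ↦ κ * r T / μ) atTop (nhds 0) := by
    simpa only [Real.sqrt_zero, zero_div, mul_zero] using
      (((tendsto_const_div_atTop_nhds_zero_nat (n * σ ^ 2)).sqrt.div_const (3 * κ)).sqrt.const_mul
        κ).div_const μ
  filter_upwards [eventually_closedBall_subset hx₀ hlim, eventually_gt_atTop 0] with T hball hT
  have hheight : κ * r T ^ 2 = √(n * σ ^ 2 / T) / 3 := by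
    rw [hr, Real.sq_sqrt (by positivity)]
    field_simp
  have hcost : T * (κ * r T ^ 2) ^ 2 / σ ^ 2 ≤ n / 8 := by
    rw [hheight, div_pow, Real.sq_sqrt (by positivity)]
    field_simp
    norm_num
  convert ofReal_le_minimaxError hκ (by linarith) (by positivity) hσ.ne' hcost hB ⟨x₀, hx₀⟩ hball
    using 2
  linear_combination -(μ - κ) * κ / (72 * μ ^ 2) * hheight

theorem theorem3 (τ L : ℝ) (hτ : 0 < τ) (hτL : τ < L) :
    ∃ c : ℝ, 0 < c ∧
      ∀ (n : ℕ), 8 ≤ n →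
      ∀ (B : Set (EuclideanSpace ℝ (Fin n))), Convex ℝ B → (interior B).Nonempty →
      ∀ (σ : ℝ), 0 < σ →
      ∀ᶠ T : ℕ in atTop,
        ENNReal.ofReal (c * √(n * σ ^ 2 / T)) ≤ DFO.minimaxError.{u} τ L σ B T := by
  obtain ⟨c, hc, hbound⟩ := theorem3_general.{u} τ L hτ hτL
  exact ⟨c, hc, fun n _ ↦ hbound n⟩
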